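/- Let $\mathcal M=\mathbb R^{2n}$ be the phase space of pairs $X=(P,Q)$ with the symplectic form $\omega((P,Q),(P',Q'))=\sum_j(P_jQ'_j-P'_jQ_j)$, and let $\mathcal L_k\subset\mathcal M$ be a $k$-dimensional isotropic subspace with skew-orthogonal complement $\mathcal L_k^{\perp\omega}=\{Y:\omega(X,Y)=0\ \forall X\in\mathcal L_k\}$ and a nonzero translation-invariant (Haar) measure $\mu$ on $\mathcal L_k$. On the Schwartz space $\mathcal S(\mathbb R^n)$ (complex-valued functions) put $\Omega(P,Q)=\sum_j\bigl(P_j\xi_j-Q_j\tfrac1i\tfrac{\partial}{\partial\xi_j}\bigr)$ and $(\psi,\varphi)=\int\psi^*\varphi\,d\xi$, and define $$\langle\psi,\varphi\rangle=\int_{\mathcal L_k}d\mu(X)\,(\psi,e^{i\Omega(X)}\varphi),\qquad f_1\sim f_2\iff\langle f_1-f_2,f_1-f_2\rangle=0 .$$ For subspaces $\mathcal A,\mathcal B\subset\mathcal M$ let $\mathrm{Sym}\,\mathcal A\otimes\mathcal B\subset\mathcal M\otimes\mathcal M$ be the span of the tensors $x\otimes y+y\otimes x$ with $x\in\mathcal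 A$, $y\in\mathcal B$, and let $\Omega_2$ be the real-linear map from $\mathcal M\otimes\mathcal M$ to operators on $\mathcal S(\mathbb R^n)$ with $\Omega_2(Z\otimes Z')=\Omega(Z)\Omega(Z')$. Let $H=\Omega_2(\Gamma)+\varepsilon$ with $\Gamma\in\mathrm{Sym}\,\mathcal M\otimes\mathcal M$ and $\varepsilon\in\mathbb R$. Then: 1. $H$ preserves the equivalence relation (i.e. $f_1\sim f_2$ implies $Hf_1\sim Hf_2$ for all $f_1,f_2\in\mathcal S(\mathbb R^n)$) if and only if $\Gamma\in\mathrm{Sym}\,\mathcal L_k^{\perp\omega}\otimes\mathcal L_k^{\perp\omega}+\mathrm{Sym}\,\mathcal L_k\otimes\mathcal M$. 2. If $H$ preserves the equivalence relation, then there exist $\Gamma'\in\mathrm{Sym}\,\mathcal L_k^{\perp\omega}\otimes\mathcal L_k^{\perp\omega}$ and a constant $\varepsilon'\in\mathbb C$ with $\mathrm{Re}\,\varepsilon'=\varepsilon$ such that $Hf\sim[\Omega_2(\Gamma')+\varepsilon']f$ for all $f\in\mathcal S(\mathbb R^n)$. -/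

import Mathlib

open scoped SchwartzMap LineDeriv TensorProduct ComplexConjugate
open MeasureTheory

noncomputable section

namespace ConstrainedQuadratic

/-- Configuration space `ℝⁿ` of the variable `ξ`. -/
abbrev Config (n : ℕ) : Type := EuclideanSpace ℝ (Fin n)

/-- Classical phase space `ℝ²ⁿ` of pairs `X = (P, Q)`. -/
abbrev PhaseSpace (n : ℕ) : Type := Config n × Config n

/-- Wave functions: the Schwartz space `𝓢(ℝⁿ)`. -/
abbrev Wave (n : ℕ) : Type := 𝓢(Config n, ℂ)

/-- The symplectic form `ω((P,Q),(P',Q')) = ∑ⱼ (Pⱼ Q'ⱼ - P'ⱼ Qⱼ)`. -/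
def symp (n : ℕ) : LinearMap.BilinForm ℝ (PhaseSpace n) :=
  LinearMap.mk₂ ℝ (fun X Y => ∑ j, (X.1 j * Y.2 j - Y.1 j * X.2 j))
    (fun X X' Y => by
      rw [← Finset.sum_add_distrib]
      refine Finset.sum_congr rfl fun j _ => ?_
      simp only [Prod.fst_add, Prod.snd_add, PiLp.add_apply]
      ring)
    (fun c X Y => by
      rw [smul_eq_mul, Finset.mul_sum]
      refine Finset.sum_congr rfl fun j _ => ?_
      simp only [Prod.smul_fst, Prod.smul_snd, PiLp.smul_apply, smul_eq_mul]
      ring)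
    (fun X Y Y' => by
      rw [← Finset.sum_add_distrib]
      refine Finset.sum_congr rfl fun j _ => ?_
      simp only [Prod.fst_add, Prod.snd_add, PiLp.add_apply]
      ring)
    (fun c X Y => by
      rw [smul_eq_mul, Finset.mul_sum]
      refine Finset.sum_congr rfl fun j _ => ?_
      simp only [Prod.smul_fst, Prod.smul_snd, PiLp.smul_apply, smul_eq_mul]
      ring)

/-- A plane on which `ω` vanishes. -/
def IsIsotropic {n : ℕ} (L : Submodule ℝ (PhaseSpace n)) : Prop :=
  ∀ X ∈ L, ∀ Y ∈ L, symp n X Y = 0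

/-- The skew-orthogonal complement of `L` with respect to `ω`. -/
def skewOrth {n : ℕ} (L : Submodule ℝ (PhaseSpace n)) : Submodule ℝ (PhaseSpace n) :=
  L.orthogonalBilin (symp n)

/-- The coordinate operator: multiplication by `ξⱼ`. -/
def coordOp {n : ℕ} (j : Fin n) : Module.End ℂ (Wave n) :=
  (SchwartzMap.smulLeftCLM ℂ (fun ξ : Config n => ((ξ j : ℝ) : ℂ))).toLinearMap

/-- The momentum operator `(1/i) ∂/∂ξⱼ`. -/
def momOp {n : ℕ} (j : Fin n) : Module.End ℂ (Wave n) :=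
  (1 / Complex.I) •
    (LineDeriv.lineDerivOpCLM ℂ (Wave n) (EuclideanSpace.single j (1 : ℝ))).toLinearMap

theorem coordOp_apply {n : ℕ} (j : Fin n) (f : Wave n) (ξ : Config n) :
    coordOp j f ξ = (ξ j : ℂ) * f ξ := by
  have h : Function.HasTemperateGrowth (fun ξ : Config n => ((ξ j : ℝ) : ℂ)) :=
    (Complex.ofRealCLM.comp (EuclideanSpace.proj j : Config n →L[ℝ] ℝ)).hasTemperateGrowth
  simp [coordOp, SchwartzMap.smulLeftCLM_apply_apply h]

theorem momOp_apply {n : ℕ} (j : Fin n) (f : Wave n) (ξ : Config n) :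
    momOp j f ξ = (1 / Complex.I) * fderiv ℝ f ξ (EuclideanSpace.single j (1 : ℝ)) := by
  simp [momOp, SchwartzMap.lineDerivOp_apply_eq_fderiv]

/-- `Ω(P,Q) = ∑ⱼ (Pⱼ ξⱼ - Qⱼ (1/i) ∂/∂ξⱼ)`, as an operator on the Schwartz space which depends
linearly on `(P,Q)`. -/
def Omega (n : ℕ) : PhaseSpace n →ₗ[ℝ] Module.End ℂ (Wave n) where
  toFun X := ∑ j, (X.1 j • coordOp j - X.2 j • momOp j)
  map_add' X Y := by
    rw [← Finset.sum_add_distrib]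
    refine Finset.sum_congr rfl fun j _ => ?_
    simp only [Prod.fst_add, Prod.snd_add, PiLp.add_apply, add_smul]
    abel
  map_smul' c X := by
    rw [Finset.smul_sum]
    refine Finset.sum_congr rfl fun j _ => ?_
    simp only [Prod.smul_fst, Prod.smul_snd, PiLp.smul_apply, smul_eq_mul, mul_smul, smul_sub,
      RingHom.id_apply]

theorem Omega_apply {n : ℕ} (X : PhaseSpace n) (f : Wave n) (ξ : Config n) :
    Omega n X f ξ = ∑ j, ((X.1 j : ℂ) * ((ξ j : ℂ) * f ξ)
      - (X.2 j : ℂ) * ((1 / Complex.I) * fderiv ℝ f ξ (EuclideanSpace.single j (1 : ℝ)))) := by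
  simp [Omega, coordOp_apply, momOp_apply, LinearMap.sum_apply, Finset.sum_add_distrib]

/-- The Weyl operator `e^{iΩ(X)}`, `X = (P,Q)`:
`(e^{iΩ(X)} f)(ξ) = e^{i (P·ξ - P·Q/2)} f(ξ - Q)`. -/
def weyl {n : ℕ} (X : PhaseSpace n) (f : Config n → ℂ) (ξ : Config n) : ℂ :=
  Complex.exp (Complex.I * ((∑ j, X.1 j * ξ j - (1 / 2) * ∑ j, X.1 j * X.2 j : ℝ) : ℂ))
    * f (ξ - X.2)

/-- The Weyl relation `e^{iΩ(X)} e^{iΩ(Y)} = e^{iΩ(X+Y)} e^{(i/2) ω(X,Y)}`. In particular,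
`t ↦ e^{iΩ(tX)}` is a one-parameter group. -/
theorem weyl_weyl {n : ℕ} (X Y : PhaseSpace n) (f : Config n → ℂ) (ξ : Config n) :
    weyl X (weyl Y f) ξ
      = Complex.exp ((Complex.I / 2) * (symp n X Y : ℂ)) * weyl (X + Y) f ξ := by
  have h : ξ - X.2 - Y.2 = ξ - (X + Y).2 := by simp [sub_sub]
  simp only [weyl]
  rw [h, ← mul_assoc, ← mul_assoc, ← Complex.exp_add, ← Complex.exp_add]
  congr 2
  have : (∑ j, X.1 j * ξ j - (1 / 2) * ∑ j, X.1 j * X.2 j)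
      + (∑ j, Y.1 j * (ξ - X.2) j - (1 / 2) * ∑ j, Y.1 j * Y.2 j)
      = (1 / 2) * symp n X Y
        + (∑ j, (X + Y).1 j * ξ j - (1 / 2) * ∑ j, (X + Y).1 j * (X + Y).2 j) := by
    simp only [symp, LinearMap.mk₂_apply, Finset.mul_sum, ← Finset.sum_sub_distrib,
      ← Finset.sum_add_distrib]
    refine Finset.sum_congr rfl fun j _ => ?_
    simp only [Prod.fst_add, Prod.snd_add, PiLp.add_apply, PiLp.sub_apply]
    ring
  rw [← mul_add, ← Complex.ofReal_add, this]
  push_cast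
  ring

/-- The generator of the one-parameter group `t ↦ e^{iΩ(tX)}` is `iΩ(X)`. -/
theorem hasDerivAt_weyl {n : ℕ} (X : PhaseSpace n) (f : Wave n) (ξ : Config n) :
    HasDerivAt (fun t : ℝ => weyl (t • X) f ξ) (Complex.I * Omega n X f ξ) 0 := by
  have h1 : HasDerivAt (fun t : ℝ => Complex.I *
      ((t * (∑ j, X.1 j * ξ j) - t ^ 2 * ((1 / 2) * ∑ j, X.1 j * X.2 j) : ℝ) : ℂ))
      (Complex.I * ((∑ j, X.1 j * ξ j : ℝ) : ℂ)) 0 := by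
    have h := ((hasDerivAt_id (0 : ℝ)).mul_const (∑ j, X.1 j * ξ j)).sub
      (((hasDerivAt_id (0 : ℝ)).pow 2).mul_const ((1 / 2) * ∑ j, X.1 j * X.2 j))
    have h' := (h.ofReal_comp).const_mul Complex.I
    convert! h' using 1
    simp
  have h2 : HasDerivAt (fun t : ℝ => f (ξ - t • X.2)) (-(fderiv ℝ f ξ X.2)) 0 := by
    have hline : HasDerivAt (fun t : ℝ => ξ - t • X.2) (-X.2) 0 := by
      simpa using ((hasDerivAt_id (0 : ℝ)).smul_const X.2).const_sub ξ
    have hf : HasFDerivAt f (fderiv ℝ f ξ) (ξ - (0 : ℝ) • X.2) := by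
      simpa using f.differentiableAt.hasFDerivAt (x := ξ)
    have h := hf.comp_hasDerivAt (0 : ℝ) hline
    rw [map_neg] at h
    exact h
  have h3 := h1.cexp.mul h2
  have hX : X.2 = ∑ j, X.2 j • EuclideanSpace.single j (1 : ℝ) := by
    ext i
    simp [Finset.sum_apply, Pi.single_apply]
  have hfd : fderiv ℝ f ξ X.2
      = ∑ j, (X.2 j : ℂ) * fderiv ℝ f ξ (EuclideanSpace.single j (1 : ℝ)) := by
    conv_lhs => rw [hX]
    simp [map_sum]
  convert! h3 using 1
  · funext t
    simp only [weyl, Prod.smul_fst, Prod.smul_snd, PiLp.smul_apply, smul_eq_mul, Pi.mul_apply]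
    congr 5
    · rw [Finset.mul_sum]
      exact Finset.sum_congr rfl fun j _ => by ring
    · simp only [Finset.mul_sum]
      exact Finset.sum_congr rfl fun j _ => by ring
  · have e : Complex.exp (Complex.I * (((0 : ℝ) * ∑ j, X.1 j * ξ j
        - (0 : ℝ) ^ 2 * ((1 / 2) * ∑ j, X.1 j * X.2 j) : ℝ) : ℂ)) = 1 := by simp
    rw [e, Omega_apply, hfd, Finset.sum_sub_distrib, mul_sub, zero_smul, sub_zero, one_mul,
      one_mul, sub_eq_add_neg]
    push_cast
    simp only [Finset.sum_mul, Finset.mul_sum]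
    congr 1
    · exact Finset.sum_congr rfl fun j _ => by ring
    · rw [← Finset.sum_neg_distrib, ← Finset.sum_neg_distrib]
      refine Finset.sum_congr rfl fun j _ => ?_
      field_simp

/-- The usual inner product `(ψ,φ) = ∫ ψ* φ dξ`. -/
def waveInner {n : ℕ} (ψ φ : Config n → ℂ) : ℂ := ∫ ξ, conj (ψ ξ) * φ ξ

/-- The inner product `⟨ψ,φ⟩ = ∫_L dμ(X) (ψ, e^{iΩ(X)} φ)` of the constrained system. -/
def physInner {n : ℕ} (L : Submodule ℝ (PhaseSpace n)) (μ : Measure L) (ψ φ : Wave n) : ℂ :=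
  ∫ X : L, waveInner ψ (weyl (X : PhaseSpace n) φ) ∂μ

/-- `f₁ ∼ f₂` iff `f₁ - f₂` has zero norm. -/
def GaugeEquiv {n : ℕ} (L : Submodule ℝ (PhaseSpace n)) (μ : Measure L) (f₁ f₂ : Wave n) : Prop :=
  physInner L μ (f₁ - f₂) (f₁ - f₂) = 0

/-- The operator `H` takes equivalent states to equivalent states. -/
def PreservesEquiv {n : ℕ} (L : Submodule ℝ (PhaseSpace n)) (μ : Measure L)
    (H : Module.End ℂ (Wave n)) : Prop :=
  ∀ f₁ f₂ : Wave n, GaugeEquiv L μ f₁ f₂ → GaugeEquiv L μ (H f₁) (H f₂)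

/-- The space `Sym A ⊗ B` of symmetrized tensors: the span of `x ⊗ y + y ⊗ x` with `x ∈ A` and
`y ∈ B`. -/
def symTensor {n : ℕ} (A B : Submodule ℝ (PhaseSpace n)) :
    Submodule ℝ (PhaseSpace n ⊗[ℝ] PhaseSpace n) :=
  Submodule.span ℝ {t | ∃ x ∈ A, ∃ y ∈ B, t = x ⊗ₜ[ℝ] y + y ⊗ₜ[ℝ] x}

/-- `Sym M ⊗ M` consists of all tensors fixed by the flip `x ⊗ y ↦ y ⊗ x`. -/
theorem mem_symTensor_top {n : ℕ} (Γ : PhaseSpace n ⊗[ℝ] PhaseSpace n) :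
    Γ ∈ symTensor (n := n) ⊤ ⊤ ↔ TensorProduct.comm ℝ _ _ Γ = Γ := by
  constructor
  · intro h
    induction h using Submodule.span_induction with
    | mem t ht =>
      obtain ⟨x, -, y, -, rfl⟩ := ht
      simp [add_comm]
    | zero => simp
    | add s t _ _ hs ht => rw [map_add, hs, ht]
    | smul c t _ ht => rw [map_smul, ht]
  · intro h
    have key : ∀ T : PhaseSpace n ⊗[ℝ] PhaseSpace n,
        T + TensorProduct.comm ℝ _ _ T ∈ symTensor (n := n) ⊤ ⊤ := by
      intro T
      induction T using TensorProduct.induction_on with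
      | zero => simp
      | tmul x y =>
        exact Submodule.subset_span ⟨x, trivial, y, trivial, by simp⟩
      | add s t hs ht =>
        rw [map_add, add_add_add_comm]
        exact add_mem hs ht
    have h2 := Submodule.smul_mem _ (1 / 2 : ℝ) (key Γ)
    rw [h, ← two_smul ℝ Γ, smul_smul] at h2
    simpa using h2

/-- The linear map `Ω₂` with `Ω₂(Z ⊗ Z') = Ω(Z) Ω(Z')`, so that
`Ω₂(½ ∑ Γᵢⱼ Zᵢ ⊗ Zⱼ) = ½ ∑ Γᵢⱼ Ω(Zᵢ) Ω(Zⱼ)`. -/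
def Omega₂ (n : ℕ) : PhaseSpace n ⊗[ℝ] PhaseSpace n →ₗ[ℝ] Module.End ℂ (Wave n) :=
  TensorProduct.lift ((LinearMap.mul ℝ (Module.End ℂ (Wave n))).compl₁₂ (Omega n) (Omega n))

/-- The quadratic Hamiltonian `H = Ω₂(Γ) + ε` with a real number `ε`. -/
def quadHam {n : ℕ} (Γ : PhaseSpace n ⊗[ℝ] PhaseSpace n) (ε : ℝ) : Module.End ℂ (Wave n) :=
  Omega₂ n Γ + (ε : ℂ) • (1 : Module.End ℂ (Wave n))

end ConstrainedQuadratic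

end

/-!
The radical `N` of `⟨·, ·⟩` governs the equivalence relation. For fixed `f` the function
`X ↦ (f, e^{iΩ(X)} f)` is positive definite on the isotropic plane `L`, so its integral
`⟨f, f⟩` is nonnegative and, by the Cauchy–Schwarz inequality, `f₁ ∼ f₂` means `f₁ - f₂ ∈ N`.

For `X ∈ L` the integrand of `⟨g, Ω(X) f⟩` is a derivative along `L`, so `Ω(X)` maps every wave
function into `N`. For `Z ∈ L^{⊥ω}` the operator `Ω(Z)` is symmetric for `⟨·, ·⟩`, so it preserves
`N`. Conversely, if `Ω(Z)` maps everything into `N`, then so does `[Ω(Y), Ω(Z)] = -i ω(Y, Z)` for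
`Y ∈ L^{⊥ω}`; as a Gaussian is not in `N`, this forces `Z ∈ L^{⊥ω⊥ω} = L`.

For symmetric `Γ` the commutator `[Ω₂(Γ), Ω(X)]` is `2i Ω(Z)`, with `Z` the contraction of `Γ` with
`ω(X, ·)`. If `Ω₂(Γ) + ε` preserves `N`, then for `X ∈ L` this commutator maps everything into `N`,
so the contractions of `Γ` with `L` lie in `L`, and linear algebra gives the decomposition of `Γ`.
Conversely, on the summand `Sym L ⊗ M` the factor in `L` can be commuted to the left at the price of
an imaginary constant, which is the difference between `ε'` and `ε`.
-/

namespace ConstrainedQuadratic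

section Contraction

variable {R V W V' W' : Type*} [CommSemiring R] [AddCommMonoid V] [AddCommMonoid W]
  [AddCommMonoid V'] [AddCommMonoid W'] [Module R V] [Module R W] [Module R V'] [Module R W']

/-- The contraction `x ⊗ y ↦ φ(y) x` of a tensor with a linear functional `φ` on its second
factor. -/
noncomputable def contractRight (φ : Module.Dual R W) : V ⊗[R] W →ₗ[R] V :=
  (TensorProduct.rid R V).toLinearMap ∘ₗ φ.lTensor V

theorem contractRight_tmul (φ : Module.Dual R W) (x : V) (y : W) :
    contractRight φ (x ⊗ₜ[R] y) = φ y • x := by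
  simp [contractRight]

theorem map_eq_sum_contractRight_tmul {ι : Type*} [Fintype ι] (b : Module.Basis ι R W')
    (f : V →ₗ[R] V') (g : W →ₗ[R] W') (T : V ⊗[R] W) :
    TensorProduct.map f g T = ∑ i, f (contractRight (b.coord i ∘ₗ g) T) ⊗ₜ[R] b i := by
  induction T with
  | zero => simp
  | tmul x y =>
    simp only [TensorProduct.map_tmul, contractRight_tmul, map_smul, LinearMap.comp_apply,
      Module.Basis.coord_apply, TensorProduct.smul_tmul]
    rw [← TensorProduct.tmul_sum, b.sum_repr]
  | add S T hS hT => simp only [map_add, TensorProduct.add_tmul, Finset.sum_add_distrib, hS, hT]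

theorem map_eq_map_of_contractRight_mem [Module.Free R W'] [Module.Finite R W']
    {U : Submodule R V} {f f' : V →ₗ[R] V'} (hf : Set.EqOn f f' U) {g : W →ₗ[R] W'}
    {T : V ⊗[R] W} (hT : ∀ φ : Module.Dual R W', contractRight (φ ∘ₗ g) T ∈ U) :
    TensorProduct.map f g T = TensorProduct.map f' g T := by
  let b := Module.Free.chooseBasis R W'
  simp only [map_eq_sum_contractRight_tmul b, hf (hT _)]

end Contraction

theorem exists_isProj {K V : Type*} [DivisionRing K] [AddCommGroup V] [Module K V]
    (U : Submodule K V) : ∃ p : V →ₗ[K] V, LinearMap.IsProj U p := by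
  obtain ⟨r, hr⟩ := LinearMap.exists_leftInverse_of_injective U.subtype U.ker_subtype
  exact ⟨U.subtype ∘ₗ r, ⟨fun x => (r x).2, fun x hx =>
    congrArg Subtype.val (LinearMap.congr_fun hr ⟨x, hx⟩)⟩⟩

section SymTensor

variable {n : ℕ}

theorem map_add_comm_map_mem_symTensor {A B : Submodule ℝ (PhaseSpace n)}
    {f g : PhaseSpace n →ₗ[ℝ] PhaseSpace n} (hf : ∀ x, f x ∈ A) (hg : ∀ x, g x ∈ B)
    (T : PhaseSpace n ⊗[ℝ] PhaseSpace n) :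
    TensorProduct.map f g T + TensorProduct.comm ℝ _ _ (TensorProduct.map f g T)
      ∈ symTensor A B := by
  induction T with
  | zero => simp
  | tmul x y => exact Submodule.subset_span ⟨f x, hf x, g y, hg y, by simp⟩
  | add S T hS hT =>
    simp only [map_add]
    rw [add_add_add_comm]
    exact add_mem hS hT

theorem mem_symTensor_sup_of_contractRight_mem {A B : Submodule ℝ (PhaseSpace n)} (hBA : B ≤ A)
    {Γ : PhaseSpace n ⊗[ℝ] PhaseSpace n} (hΓ : Γ ∈ symTensor (n := n) ⊤ ⊤)
    (hB : ∀ φ : Module.Dual ℝ (PhaseSpace n), (∀ x ∈ A, φ x = 0) → contractRight φ Γ ∈ B) :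
    Γ ∈ symTensor A A ⊔ symTensor B ⊤ := by
  obtain ⟨p, hp⟩ := exists_isProj A
  obtain ⟨q, hq⟩ := exists_isProj B
  rw [mem_symTensor_top] at hΓ
  set c : PhaseSpace n →ₗ[ℝ] PhaseSpace n := LinearMap.id - p with hc
  have hcB (φ : Module.Dual ℝ (PhaseSpace n)) : contractRight (φ ∘ₗ c) Γ ∈ B :=
    hB _ fun x hx => by simp [c, hp.map_id x hx]
  have hpc : TensorProduct.map p c Γ = TensorProduct.map q c Γ :=
    map_eq_map_of_contractRight_mem
      (fun x hx => (hp.map_id x (hBA hx)).trans (hq.map_id x hx).symm) hcB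
  have hid : TensorProduct.map LinearMap.id c Γ = TensorProduct.map q c Γ :=
    map_eq_map_of_contractRight_mem (fun x hx => (hq.map_id x hx).symm) hcB
  have hcp : TensorProduct.map c p Γ = TensorProduct.comm ℝ _ _ (TensorProduct.map q c Γ) := by
    rw [← hpc, ← TensorProduct.map_comm, hΓ]
  have hpp : TensorProduct.map p p Γ = (1 / 2 : ℝ) • (TensorProduct.map p p Γ
      + TensorProduct.comm ℝ _ _ (TensorProduct.map p p Γ)) := by
    rw [← TensorProduct.map_comm, hΓ]
    module
  have hdecomp : Γ = TensorProduct.map p p Γ + (TensorProduct.map q c Γ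
      + TensorProduct.comm ℝ _ _ (TensorProduct.map q c Γ)) := by
    calc Γ = TensorProduct.map (p + c) p Γ + TensorProduct.map LinearMap.id c Γ := by
          rw [hc, add_sub_cancel, ← LinearMap.add_apply, ← TensorProduct.map_add_right,
            add_sub_cancel, TensorProduct.map_id, LinearMap.id_apply]
      _ = _ := by
          rw [TensorProduct.map_add_left, LinearMap.add_apply, hid, hcp, add_assoc,
            add_comm (TensorProduct.comm ℝ _ _ _)]
  rw [hdecomp, hpp]
  exact add_mem
    (Submodule.mem_sup_left <| Submodule.smul_mem _ _ <|
      map_add_comm_map_mem_symTensor hp.map_mem hp.map_mem Γ)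
    (Submodule.mem_sup_right <|
      map_add_comm_map_mem_symTensor hq.map_mem (fun _ => Submodule.mem_top) Γ)

end SymTensor

section Symplectic

variable {n : ℕ}

theorem symp_isAlt : (symp n).IsAlt := fun X => by
  simp [symp]

theorem symp_zero_single (X : PhaseSpace n) (j : Fin n) :
    symp n X (0, EuclideanSpace.single j 1) = X.1 j := by
  simp [symp]

theorem symp_single_zero (X : PhaseSpace n) (j : Fin n) :
    symp n X (EuclideanSpace.single j 1, 0) = -X.2 j := by
  simp [symp]

theorem symp_nondegenerate : (symp n).Nondegenerate := by
  refine symp_isAlt.isRefl.nondegenerate_iff_separatingLeft.2 fun X hX =>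
    Prod.ext (PiLp.ext fun j => ?_) (PiLp.ext fun j => ?_)
  · exact (symp_zero_single X j).symm.trans (hX _)
  · exact neg_eq_zero.1 ((symp_single_zero X j).symm.trans (hX _))

variable {L : Submodule ℝ (PhaseSpace n)}

theorem IsIsotropic.le_skewOrth (hL : IsIsotropic L) : L ≤ skewOrth L :=
  fun X hX Y hY => hL Y hY X hX

theorem skewOrth_skewOrth (L : Submodule ℝ (PhaseSpace n)) : skewOrth (skewOrth L) = L :=
  LinearMap.BilinForm.orthogonal_orthogonal symp_nondegenerate symp_isAlt.isRefl L

theorem exists_symp_eq {φ : Module.Dual ℝ (PhaseSpace n)} (hφ : ∀ Y ∈ skewOrth L, φ Y = 0) :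
    ∃ X ∈ L, symp n X = φ := by
  obtain ⟨X, rfl⟩ := ((symp n).toDual symp_nondegenerate).surjective φ
  refine ⟨X, ?_, rfl⟩
  rw [← skewOrth_skewOrth L]
  exact fun Y hY => symp_isAlt.isRefl _ _ (hφ Y hY)

end Symplectic

section PositiveDefinite

open Filter Topology

variable {𝕜 H : Type*} [RCLike 𝕜] [NormedAddCommGroup H] [InnerProductSpace 𝕜 H]

theorem integral_integral_inner_self [NormedSpace ℝ H] [CompleteSpace H] {X : Type*}
    [MeasurableSpace X] {ν : Measure X} {u : X → H} (hu : Integrable u ν) :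
    ∫ x, ∫ y, inner 𝕜 (u x) (u y) ∂ν ∂ν = (‖∫ x, u x ∂ν‖ : 𝕜) ^ 2 := by
  simp only [integral_inner hu]
  rw [← inner_self_eq_norm_sq_to_K, ← inner_conj_symm, ← integral_inner hu, ← integral_conj]
  simp only [inner_conj_symm]

theorem continuous_of_inner_eq {G : Type*} [TopologicalSpace G] [AddGroup G] [ContinuousSub G]
    {u : G → H} {F : G → 𝕜} (hF : Continuous F) (hu : ∀ x y, inner 𝕜 (u x) (u y) = F (y - x)) :
    Continuous u := by
  have hsq (x y : G) : ‖u y - u x‖ ^ 2 = 2 * RCLike.re (F 0) - 2 * RCLike.re (F (x - y)) := by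
    rw [@norm_sub_sq 𝕜, hu, norm_sq_eq_re_inner (𝕜 := 𝕜), norm_sq_eq_re_inner (𝕜 := 𝕜), hu, hu,
      sub_self, sub_self]
    ring
  refine continuous_iff_continuousAt.2 fun x => tendsto_iff_norm_sub_tendsto_zero.2 ?_
  have hcont : Continuous fun y => √(2 * RCLike.re (F 0) - 2 * RCLike.re (F (x - y))) := by
    fun_prop
  simpa [← hsq] using hcont.tendsto x

variable {V : Type*} [NormedAddCommGroup V] [NormedSpace ℝ V] [MeasurableSpace V] [BorelSpace V]

theorem setIntegral_comp_smul_sub [FiniteDimensional ℝ V] (μ : Measure V) [μ.IsAddHaarMeasure]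
    {E : Type*} [NormedAddCommGroup E] [NormedSpace ℝ E] (F : V → E) {B : Set V}
    (hB : MeasurableSet B) {R : ℝ} (hR : 0 < R) (x : V) :
    ∫ y in B, F (R • (y - x)) ∂μ
      = (R ^ Module.finrank ℝ V)⁻¹ • ∫ z, {z | x + R⁻¹ • z ∈ B}.indicator F z ∂μ := by
  rw [← integral_indicator hB, ← integral_add_left_eq_self _ x,
    ← abs_of_pos (inv_pos.2 (pow_pos hR _)), ← Measure.integral_comp_smul]
  congr 1 with y
  by_cases hy : x + y ∈ B <;> simp [inv_smul_smul₀ hR.ne', hy]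

theorem tendsto_integral_indicator_nhds {μ : Measure V} {E : Type*} [NormedAddCommGroup E]
    [NormedSpace ℝ E] {F : V → E} (hF : Integrable F μ) {B : Set V} (hB : IsOpen B) {x : V}
    (hx : x ∈ B) :
    Tendsto (fun k : ℕ => ∫ z, {z | x + (k + 1 : ℝ)⁻¹ • z ∈ B}.indicator F z ∂μ) atTop
      (𝓝 (∫ z, F z ∂μ)) := by
  refine tendsto_integral_of_dominated_convergence (fun z => ‖F z‖)
    (fun k => hF.aestronglyMeasurable.indicator ?_) hF.norm
    (fun k => .of_forall fun z => norm_indicator_le_norm_self _ _) (.of_forall fun z => ?_)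
  · exact (hB.preimage (by fun_prop)).measurableSet
  · have hz : Tendsto (fun k : ℕ => x + (k + 1 : ℝ)⁻¹ • z) atTop (𝓝 x) := by
      simpa using (tendsto_one_div_add_atTop_nhds_zero_nat (𝕜 := ℝ)).smul_const z |>.const_add x
    refine tendsto_const_nhds.congr' ?_
    filter_upwards [hz (hB.mem_nhds hx)] with k hk
    exact (Set.indicator_of_mem (s := {z | x + (k + 1 : ℝ)⁻¹ • z ∈ B}) hk F).symm

-- `‖∫_B u(R x) dx‖²`, rescaled by a power of `R`, is nonnegative and tends to `|B| ∫ F`.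
theorem re_integral_nonneg_of_inner_eq [FiniteDimensional ℝ V] [NormedSpace ℝ H]
    [CompleteSpace H] {μ : Measure V} [μ.IsAddHaarMeasure] {u : V → H} {F : V → 𝕜}
    (hFc : Continuous F) (hF : Integrable F μ) (hu : ∀ x y, inner 𝕜 (u x) (u y) = F (y - x)) :
    0 ≤ RCLike.re (∫ x, F x ∂μ) := by
  have huc := continuous_of_inner_eq hFc hu
  set B : Set V := Metric.ball 0 1
  have hB : 0 < μ.real B :=
    ENNReal.toReal_pos (Metric.measure_ball_pos μ 0 one_pos).ne' measure_ball_lt_top.ne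
  set A : ℕ → V → 𝕜 := fun k x => ∫ z, {z | x + (k + 1 : ℝ)⁻¹ • z ∈ B}.indicator F z ∂μ
  have hui (k : ℕ) : IntegrableOn (fun x => u ((k + 1 : ℝ) • x)) B μ :=
    ((by fun_prop : Continuous fun x => u ((k + 1 : ℝ) • x)).continuousOn.integrableOn_compact
      (isCompact_closedBall 0 1)).mono_set Metric.ball_subset_closedBall
  have hA (k : ℕ) (x : V) : A k x = ((k + 1 : ℝ) ^ Module.finrank ℝ V) •
      ∫ y in B, inner 𝕜 (u ((k + 1 : ℝ) • x)) (u ((k + 1 : ℝ) • y)) ∂μ := by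
    simp only [hu, ← smul_sub]
    rw [setIntegral_comp_smul_sub μ F measurableSet_ball (by positivity),
      smul_inv_smul₀ (by positivity)]
  have hnonneg (k : ℕ) : 0 ≤ RCLike.re (∫ x in B, A k x ∂μ) := by
    simp only [hA]
    rw [integral_smul, integral_integral_inner_self (hui k), RCLike.smul_re, ← RCLike.ofReal_pow,
      RCLike.ofReal_re]
    positivity
  have hlim : Tendsto (fun k => ∫ x in B, A k x ∂μ) atTop (𝓝 (∫ _ in B, ∫ z, F z ∂μ ∂μ)) := by
    refine tendsto_integral_of_dominated_convergence (fun _ => ∫ z, ‖F z‖ ∂μ) (fun k => ?_)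
      (integrableOn_const measure_ball_lt_top.ne) (fun k => .of_forall fun _ => ?_) ?_
    · simp only [funext (hA k), integral_inner (hui k)]
      exact Continuous.aestronglyMeasurable (by fun_prop)
    · exact norm_integral_le_of_norm_le hF.norm
        (.of_forall fun z => norm_indicator_le_norm_self _ _)
    · filter_upwards [ae_restrict_mem measurableSet_ball] with x hx
      exact tendsto_integral_indicator_nhds hF Metric.isOpen_ball hx
  have hre := ge_of_tendsto' ((RCLike.continuous_re.tendsto _).comp hlim) hnonneg
  rw [setIntegral_const, RCLike.smul_re] at hre
  exact nonneg_of_mul_nonneg_right hre hB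

end PositiveDefinite

section Weyl

variable {n : ℕ}

theorem sum_smul_single (x : Config n) : ∑ j, x j • EuclideanSpace.single j (1 : ℝ) = x := by
  simpa using (EuclideanSpace.basisFun (Fin n) ℝ).sum_repr x

theorem Omega_apply_eq_inner (X : PhaseSpace n) (f : Wave n) (ξ : Config n) :
    Omega n X f ξ = (inner ℝ X.1 ξ : ℝ) * f ξ + Complex.I * fderiv ℝ f ξ X.2 := by
  conv_rhs => rw [← sum_smul_single X.2]
  simp only [Omega_apply, PiLp.inner_apply, map_sum, map_smul, Complex.ofReal_sum, Finset.sum_mul,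
    Finset.mul_sum, ← Finset.sum_add_distrib]
  refine Finset.sum_congr rfl fun j _ => ?_
  simp only [RCLike.inner_apply, conj_trivial, Complex.ofReal_mul, Complex.real_smul, one_div,
    Complex.inv_I]
  ring

theorem fderiv_Omega (Y : PhaseSpace n) (f : Wave n) (ξ v : Config n) :
    fderiv ℝ (Omega n Y f) ξ v = (inner ℝ Y.1 v : ℝ) * f ξ + (inner ℝ Y.1 ξ : ℝ) * fderiv ℝ f ξ v
      + Complex.I * fderiv ℝ (fderiv ℝ f) ξ v Y.2 := by
  have hf : HasFDerivAt f (fderiv ℝ f ξ) ξ := f.differentiableAt.hasFDerivAt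
  have hf' : HasFDerivAt (fderiv ℝ f) (fderiv ℝ (fderiv ℝ f) ξ) ξ :=
    (((f.smooth 2).fderiv_right (m := 1) le_rfl).differentiable one_ne_zero ξ).hasFDerivAt
  have hinner : HasFDerivAt (fun η => ((inner ℝ Y.1 η : ℝ) : ℂ))
      (Complex.ofRealCLM ∘L innerSL ℝ Y.1) ξ :=
    (Complex.ofRealCLM ∘L innerSL ℝ Y.1).hasFDerivAt
  have h := (hinner.mul hf).add ((hf'.clm_apply (hasFDerivAt_const Y.2 ξ)).const_mul Complex.I)
  rw [(h.congr_of_eventuallyEq (.of_forall (Omega_apply_eq_inner Y f))).fderiv]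
  simp only [ContinuousLinearMap.comp_zero, zero_add, add_apply, smul_apply, smul_eq_mul,
    ContinuousLinearMap.comp_apply, coe_innerSL_apply, Complex.ofRealCLM_apply,
    ContinuousLinearMap.flip_apply]
  ring

theorem Omega_Omega (X Y : PhaseSpace n) (f : Wave n) :
    Omega n X (Omega n Y f) = Omega n Y (Omega n X f) - (Complex.I * symp n X Y) • f := by
  ext ξ
  have hsymm : fderiv ℝ (fderiv ℝ f) ξ X.2 Y.2 = fderiv ℝ (fderiv ℝ f) ξ Y.2 X.2 :=
    ((f.smooth 2).contDiffAt.isSymmSndFDerivAt (by simp)).eq X.2 Y.2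
  have hsymp : symp n X Y = inner ℝ X.1 Y.2 - inner ℝ Y.1 X.2 := by
    simp [symp, PiLp.inner_apply, mul_comm]
  simp only [sub_apply, smul_apply, smul_eq_mul, Omega_apply_eq_inner, fderiv_Omega, hsymm, hsymp]
  push_cast
  ring

theorem norm_weyl (X : PhaseSpace n) (f : Config n → ℂ) (ξ : Config n) :
    ‖weyl X f ξ‖ = ‖f (ξ - X.2)‖ := by
  rw [weyl, norm_mul, mul_comm Complex.I, Complex.norm_exp_ofReal_mul_I, one_mul]

theorem weyl_weyl_of_symp_eq_zero {X Y : PhaseSpace n} (h : symp n X Y = 0) (f : Config n → ℂ) :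
    weyl X (weyl Y f) = weyl (X + Y) f := by
  funext ξ
  simp only [weyl_weyl, h, Complex.ofReal_zero, mul_zero, Complex.exp_zero, one_mul]

theorem continuous_weyl (f : Wave n) :
    Continuous (Function.uncurry fun (X : PhaseSpace n) ξ => weyl X f ξ) := by
  unfold weyl
  have := f.continuous
  fun_prop

theorem hasLineDerivAt_weyl (X Z : PhaseSpace n) (f : Wave n) (ξ : Config n) :
    HasLineDerivAt ℝ (fun Y => weyl Y f ξ)
      (Complex.I * weyl X (Omega n Z f) ξ - Complex.I / 2 * symp n X Z * weyl X f ξ) X Z := by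
  have hphase : HasDerivAt
      (fun t : ℝ => Complex.exp (-(Complex.I / 2 * (symp n X Z : ℂ)) * (t : ℂ)))
      (-(Complex.I / 2 * (symp n X Z : ℂ))) 0 := by
    simpa using ((hasDerivAt_id (0 : ℝ)).ofReal_comp.const_mul
      (-(Complex.I / 2 * (symp n X Z : ℂ)))).cexp
  have hgroup := (hasDerivAt_weyl Z f (ξ - X.2)).const_mul
    (Complex.exp (Complex.I * ((∑ j, X.1 j * ξ j - (1 / 2) * ∑ j, X.1 j * X.2 j : ℝ) : ℂ)))
  have hsplit (t : ℝ) : weyl (X + t • Z) f ξ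
      = Complex.exp (-(Complex.I / 2 * (symp n X Z : ℂ)) * (t : ℂ))
        * weyl X (weyl (t • Z) f) ξ := by
    rw [weyl_weyl, ← mul_assoc, ← Complex.exp_add, map_smul, smul_eq_mul, Complex.ofReal_mul,
      neg_mul, mul_left_comm, mul_comm (t : ℂ), neg_add_cancel, Complex.exp_zero, one_mul]
  refine ((hphase.mul hgroup).congr_of_eventuallyEq (.of_forall hsplit)).congr_deriv ?_
  simp only [weyl, zero_smul, Prod.fst_zero, Prod.snd_zero, PiLp.zero_apply, zero_mul,
    Finset.sum_const_zero, mul_zero, sub_zero, Complex.ofReal_zero, Complex.exp_zero, one_mul]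
  ring

theorem hasDerivAt_weyl_add_smul (X Z : PhaseSpace n) (f : Wave n) (ξ : Config n) (t : ℝ) :
    HasDerivAt (fun s : ℝ => weyl (X + s • Z) f ξ)
      (Complex.I * weyl (X + t • Z) (Omega n Z f) ξ
        - Complex.I / 2 * symp n X Z * weyl (X + t • Z) f ξ) t := by
  have h : HasLineDerivAt ℝ (fun Y => weyl Y f ξ) _ (X + t • Z) Z :=
    hasLineDerivAt_weyl (X + t • Z) Z f ξ
  rw [HasLineDerivAt, ← sub_self t] at h
  have hshift := h.comp_sub_const t t
  simp only [add_assoc, ← add_smul, add_sub_cancel] at hshift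
  simpa only [map_add, map_smul, LinearMap.add_apply, LinearMap.smul_apply,
    symp_isAlt.self_eq_zero, smul_zero, add_zero] using hshift

theorem conj_waveInner (g f : Config n → ℂ) : conj (waveInner g f) = waveInner f g := by
  simp only [waveInner, ← integral_conj, map_mul, Complex.conj_conj, mul_comm]

theorem waveInner_weyl_left (X : PhaseSpace n) (g f : Config n → ℂ) :
    waveInner (weyl X g) f = waveInner g (weyl (-X) f) := by
  rw [waveInner, waveInner,
    ← integral_add_right_eq_self (fun ξ => conj (weyl X g ξ) * f ξ) X.2]
  refine integral_congr_ae (.of_forall fun ξ => ?_)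
  simp only [weyl, map_mul, ← Complex.exp_conj, Complex.conj_I, Complex.conj_ofReal,
    add_sub_cancel_right, Prod.fst_neg, Prod.snd_neg, sub_neg_eq_add, PiLp.neg_apply,
    PiLp.add_apply]
  rw [mul_comm (Complex.exp _), mul_assoc]
  congr 3
  push_cast
  simp only [mul_add, Finset.sum_add_distrib, neg_mul, mul_neg, Finset.sum_neg_distrib]
  ring

theorem conj_waveInner_weyl (X : PhaseSpace n) (g f : Config n → ℂ) :
    conj (waveInner g (weyl X f)) = waveInner f (weyl (-X) g) := by
  rw [conj_waveInner, waveInner_weyl_left]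

theorem norm_conj_mul_weyl_le (g f : Wave n) (X : PhaseSpace n) (ξ : Config n) :
    ‖conj (g ξ) * weyl X f ξ‖ ≤ ‖g ξ‖ * SchwartzMap.seminorm ℝ 0 0 f := by
  rw [norm_mul, RCLike.norm_conj, norm_weyl]
  gcongr
  exact SchwartzMap.norm_le_seminorm ℝ f _

theorem integrable_conj_mul_weyl (g f : Wave n) (X : PhaseSpace n) :
    Integrable fun ξ => conj (g ξ) * weyl X f ξ := by
  refine (g.integrable.norm.mul_const _).mono' ?_ (.of_forall (norm_conj_mul_weyl_le g f X))
  exact ((Complex.continuous_conj.comp g.continuous).mul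
    ((continuous_weyl f).uncurry_left X)).aestronglyMeasurable

theorem waveInner_weyl_add (g : Wave n) (X : PhaseSpace n) (f f' : Wave n) :
    waveInner g (weyl X (f + f' : Wave n)) = waveInner g (weyl X f) + waveInner g (weyl X f') := by
  simp only [waveInner]
  rw [← integral_add (integrable_conj_mul_weyl g f X) (integrable_conj_mul_weyl g f' X)]
  simp only [weyl, add_apply, mul_add]

theorem waveInner_weyl_smul (g : Config n → ℂ) (X : PhaseSpace n) (c : ℂ) (f : Wave n) :
    waveInner g (weyl X (c • f : Wave n)) = c * waveInner g (weyl X f) := by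
  simp only [waveInner, ← integral_const_mul, weyl, smul_apply, smul_eq_mul, mul_left_comm]

theorem norm_waveInner_weyl_le (g f : Wave n) (X : PhaseSpace n) :
    ‖waveInner g (weyl X f)‖ ≤ ∫ ξ, ‖g ξ‖ * SchwartzMap.seminorm ℝ 0 0 f :=
  norm_integral_le_of_norm_le (g.integrable.norm.mul_const _)
    (.of_forall (norm_conj_mul_weyl_le g f X))

theorem continuous_waveInner_weyl (g f : Wave n) :
    Continuous fun X : PhaseSpace n => waveInner g (weyl X f) := by
  have hcont (ξ : Config n) : Continuous fun X => conj (g ξ) * weyl X f ξ :=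
    continuous_const.mul ((continuous_weyl f).uncurry_right ξ)
  exact continuous_of_dominated (fun X => (integrable_conj_mul_weyl g f X).aestronglyMeasurable)
    (fun X => .of_forall (norm_conj_mul_weyl_le g f X)) (g.integrable.norm.mul_const _)
    (.of_forall hcont)

theorem hasLineDerivAt_waveInner_weyl (g f : Wave n) (X Z : PhaseSpace n) :
    HasLineDerivAt ℝ (fun Y => waveInner g (weyl Y f))
      (Complex.I * waveInner g (weyl X (Omega n Z f))
        - Complex.I / 2 * symp n X Z * waveInner g (weyl X f)) X Z := by
  have hint (h : Wave n) (t : ℝ) : Integrable fun ξ => conj (g ξ) * weyl (X + t • Z) h ξ :=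
    integrable_conj_mul_weyl g h _
  let F' (t : ℝ) (ξ : Config n) : ℂ :=
    Complex.I * (conj (g ξ) * weyl (X + t • Z) (Omega n Z f) ξ)
      - Complex.I / 2 * symp n X Z * (conj (g ξ) * weyl (X + t • Z) f ξ)
  have hderiv (ξ : Config n) (t : ℝ) :
      HasDerivAt (fun t : ℝ => conj (g ξ) * weyl (X + t • Z) f ξ) (F' t ξ) t :=
    ((hasDerivAt_weyl_add_smul X Z f ξ t).const_mul _).congr_deriv (by simp only [F']; ring)
  have hbound (ξ : Config n) (t : ℝ) : ‖F' t ξ‖ ≤ ‖g ξ‖ * (SchwartzMap.seminorm ℝ 0 0 (Omega n Z f)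
      + ‖Complex.I / 2 * symp n X Z‖ * SchwartzMap.seminorm ℝ 0 0 f) := by
    refine (norm_sub_le _ _).trans ?_
    rw [norm_mul, Complex.norm_I, one_mul, norm_mul (_ * _), mul_add, mul_left_comm ‖g ξ‖]
    gcongr <;> exact norm_conj_mul_weyl_le g _ _ ξ
  have hmeas : AEStronglyMeasurable (F' 0) :=
    (((hint _ 0).const_mul _).sub ((hint f 0).const_mul _)).aestronglyMeasurable
  have h := (hasDerivAt_integral_of_dominated_loc_of_deriv_le (F' := F') Filter.univ_mem
    (.of_forall fun t => (hint f t).aestronglyMeasurable) (hint f 0) hmeas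
    (.of_forall fun ξ t _ => hbound ξ t) (g.integrable.norm.mul_const _)
    (.of_forall fun ξ t _ => hderiv ξ t)).2
  simp only [F', zero_smul, add_zero] at h
  rwa [integral_sub ((integrable_conj_mul_weyl g _ X).const_mul _)
    ((integrable_conj_mul_weyl g f X).const_mul _), integral_const_mul, integral_const_mul] at h

theorem waveInner_Omega_left (g f : Wave n) (X Z : PhaseSpace n) :
    waveInner (Omega n Z g) (weyl X f)
      = waveInner g (weyl X (Omega n Z f)) - symp n X Z * waveInner g (weyl X f) := by
  have hright := hasLineDerivAt_waveInner_weyl g f X Z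
  have hleft := (hasLineDerivAt_waveInner_weyl f g (-X) (-Z)).star
  have hneg : waveInner f (weyl (-X) (Omega n (-Z) g))
      = -waveInner f (weyl (-X) (Omega n Z g)) := by
    simpa using waveInner_weyl_smul f (-X) (-1) (Omega n Z g)
  simp only [hneg, smul_neg, ← neg_add, RCLike.star_def, conj_waveInner_weyl, neg_neg] at hleft
  have h := hright.unique hleft
  simp only [map_neg, LinearMap.neg_apply, neg_neg, map_sub, map_mul, Complex.conj_I,
    map_div₀, Complex.conj_ofReal, Complex.conj_ofNat, conj_waveInner_weyl] at h
  refine mul_left_cancel₀ Complex.I_ne_zero ?_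
  linear_combination -h

theorem norm_phaseSpace_le (X : PhaseSpace n) :
    ‖X‖ ≤ ∑ j, (|symp n X (0, EuclideanSpace.single j 1)|
      + |symp n X (EuclideanSpace.single j 1, 0)|) := by
  have hnorm (x : Config n) : ‖x‖ ≤ ∑ j, |x j| := by
    conv_lhs => rw [← sum_smul_single x]
    refine (norm_sum_le _ _).trans_eq (Finset.sum_congr rfl fun j _ => ?_)
    rw [norm_smul, PiLp.norm_single, norm_one, mul_one, Real.norm_eq_abs]
  simp only [symp_zero_single, symp_single_zero, abs_neg, Finset.sum_add_distrib]
  exact norm_prod_le_iff.2 ⟨le_add_of_le_of_nonneg (hnorm _) (by positivity),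
    le_add_of_nonneg_of_le (by positivity) (hnorm _)⟩

theorem abs_symp_mul_norm_waveInner_le (g f : Wave n) (X Z : PhaseSpace n) :
    |symp n X Z| * ‖waveInner g (weyl X f)‖
      ≤ ‖waveInner g (weyl X (Omega n Z f))‖ + ‖waveInner (Omega n Z g) (weyl X f)‖ := by
  have h : (symp n X Z : ℂ) * waveInner g (weyl X f)
      = waveInner g (weyl X (Omega n Z f)) - waveInner (Omega n Z g) (weyl X f) := by
    rw [waveInner_Omega_left, sub_sub_cancel]
  rw [← Real.norm_eq_abs, ← Complex.norm_real, ← norm_mul, h]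
  exact norm_sub_le _ _

theorem exists_pow_mul_norm_waveInner_le (k : ℕ) (g f : Wave n) :
    ∃ C : ℝ, ∀ X : PhaseSpace n, ‖X‖ ^ k * ‖waveInner g (weyl X f)‖ ≤ C := by
  induction k generalizing g f with
  | zero => exact ⟨_, fun X => by simpa using norm_waveInner_weyl_le g f X⟩
  | succ k ih =>
    have hstep (Z : PhaseSpace n) : ∃ C : ℝ, ∀ X : PhaseSpace n,
        ‖X‖ ^ k * (|symp n X Z| * ‖waveInner g (weyl X f)‖) ≤ C := by
      obtain ⟨C₁, h₁⟩ := ih g (Omega n Z f)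
      obtain ⟨C₂, h₂⟩ := ih (Omega n Z g) f
      refine ⟨C₁ + C₂, fun X => le_trans ?_ (add_le_add (h₁ X) (h₂ X))⟩
      rw [← mul_add]
      gcongr
      exact abs_symp_mul_norm_waveInner_le g f X Z
    choose C hC using hstep
    refine ⟨∑ j : Fin n, (C (0, EuclideanSpace.single j 1) + C (EuclideanSpace.single j 1, 0)),
      fun X => ?_⟩
    calc ‖X‖ ^ (k + 1) * ‖waveInner g (weyl X f)‖
        = ‖X‖ ^ k * (‖X‖ * ‖waveInner g (weyl X f)‖) := by ring
      _ ≤ ‖X‖ ^ k * ((∑ j, (|symp n X (0, EuclideanSpace.single j 1)|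
          + |symp n X (EuclideanSpace.single j 1, 0)|)) * ‖waveInner g (weyl X f)‖) := by
        gcongr
        exact norm_phaseSpace_le X
      _ ≤ _ := by
        simp only [Finset.sum_mul, Finset.mul_sum, add_mul, mul_add]
        exact Finset.sum_le_sum fun j _ => add_le_add (hC _ X) (hC _ X)

theorem integrable_waveInner_weyl (L : Submodule ℝ (PhaseSpace n)) (μ : Measure L)
    [μ.HasTemperateGrowth] (g f : Wave n) :
    Integrable (fun X : L => waveInner g (weyl (X : PhaseSpace n) f)) μ := by
  obtain ⟨C, hC⟩ := exists_pow_mul_norm_waveInner_le (0 + μ.integrablePower) g f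
  have hcont : Continuous fun X : L => waveInner g (weyl (X : PhaseSpace n) f) :=
    (continuous_waveInner_weyl g f).comp continuous_subtype_val
  have h := integrable_of_le_of_pow_mul_le (μ := μ) (k := 0)
    (fun X => norm_waveInner_weyl_le g f (X : PhaseSpace n)) (fun X => hC X)
    hcont.aestronglyMeasurable
  simp only [pow_zero, one_mul] at h
  exact (integrable_norm_iff hcont.aestronglyMeasurable).1 h

end Weyl

section PhysInner

variable {n : ℕ} {L : Submodule ℝ (PhaseSpace n)} (μ : Measure L)

theorem physInner_add_right [μ.HasTemperateGrowth] (g f f' : Wave n) :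
    physInner L μ g (f + f') = physInner L μ g f + physInner L μ g f' := by
  simp only [physInner, waveInner_weyl_add]
  exact integral_add (integrable_waveInner_weyl L μ g f) (integrable_waveInner_weyl L μ g f')

theorem physInner_smul_right (g : Wave n) (c : ℂ) (f : Wave n) :
    physInner L μ g (c • f) = c * physInner L μ g f := by
  simp only [physInner, waveInner_weyl_smul, integral_const_mul]

theorem conj_physInner [μ.IsNegInvariant] (g f : Wave n) :
    conj (physInner L μ g f) = physInner L μ f g := by
  rw [physInner, physInner, ← integral_conj, ← integral_neg_eq_self _ μ]
  simp only [conj_waveInner_weyl, NegMemClass.coe_neg, neg_neg]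

theorem physInner_Omega_left {Z : PhaseSpace n} (hZ : Z ∈ skewOrth L) (g f : Wave n) :
    physInner L μ (Omega n Z g) f = physInner L μ g (Omega n Z f) := by
  refine integral_congr_ae (.of_forall fun X => ?_)
  have h : symp n X Z = 0 := hZ X X.2
  simp only [waveInner_Omega_left, h, Complex.ofReal_zero, zero_mul, sub_zero]

theorem physInner_Omega_right_eq_zero [μ.IsAddHaarMeasure] (hL : IsIsotropic L)
    {Z : PhaseSpace n} (hZ : Z ∈ L) (g f : Wave n) : physInner L μ g (Omega n Z f) = 0 := by
  have hderiv (X : L) : HasLineDerivAt ℝ (fun X : L => waveInner g (weyl (X : PhaseSpace n) f))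
      (Complex.I * waveInner g (weyl (X : PhaseSpace n) (Omega n Z f))) X ⟨Z, hZ⟩ := by
    have h := hasLineDerivAt_waveInner_weyl g f X Z
    rwa [hL X X.2 Z hZ, Complex.ofReal_zero, mul_zero, zero_mul, sub_zero] at h
  have h := integral_bilinear_hasLineDerivAt_right_eq_neg_left_of_integrable (μ := μ)
    (B := ContinuousLinearMap.mul ℝ ℂ) (f := fun _ : L => (1 : ℂ)) (f' := fun _ => 0)
    (v := ⟨Z, hZ⟩) (by simp)
    (by simpa using (integrable_waveInner_weyl L μ g (Omega n Z f)).const_mul Complex.I)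
    (by simpa using integrable_waveInner_weyl L μ g f)
    (fun X _ => hasDerivAt_const _ _) (fun X _ => hderiv X)
  simpa only [physInner, ContinuousLinearMap.mul_apply', one_mul, zero_mul, integral_zero, neg_zero,
    integral_const_mul, mul_eq_zero, Complex.I_ne_zero, false_or] using h

theorem memLp_weyl (X : PhaseSpace n) (f : Wave n) : MemLp (weyl X f) 2 :=
  ((f.memLp 2).comp_measurePreserving (measurePreserving_sub_right volume X.2)).congr_norm
    ((continuous_weyl f).uncurry_left X).aestronglyMeasurable
    (.of_forall fun ξ => (norm_weyl X f ξ).symm)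

theorem inner_toLp_weyl (hL : IsIsotropic L) (f : Wave n) (X Y : L) :
    inner ℂ (memLp_weyl (X : PhaseSpace n) f).toLp (memLp_weyl (Y : PhaseSpace n) f).toLp
      = waveInner f (weyl ((Y - X : L) : PhaseSpace n) f) := by
  have h : symp n (-X : PhaseSpace n) Y = 0 := hL _ (neg_mem X.2) _ Y.2
  have hinner : inner ℂ (memLp_weyl (X : PhaseSpace n) f).toLp
      (memLp_weyl (Y : PhaseSpace n) f).toLp
        = waveInner (weyl (X : PhaseSpace n) f) (weyl (Y : PhaseSpace n) f) := by
    rw [L2.inner_def]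
    refine integral_congr_ae ?_
    filter_upwards [(memLp_weyl (X : PhaseSpace n) f).coeFn_toLp,
      (memLp_weyl (Y : PhaseSpace n) f).coeFn_toLp] with ξ hX hY
    rw [hX, hY, RCLike.inner_apply']
  rw [hinner, waveInner_weyl_left, weyl_weyl_of_symp_eq_zero h, AddSubgroupClass.coe_sub,
    neg_add_eq_sub]

theorem re_physInner_self_nonneg [μ.IsAddHaarMeasure] (hL : IsIsotropic L) (f : Wave n) :
    0 ≤ (physInner L μ f f).re :=
  re_integral_nonneg_of_inner_eq
    ((continuous_waveInner_weyl f f).comp continuous_subtype_val)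
    (integrable_waveInner_weyl L μ f f) (inner_toLp_weyl hL f)

theorem physInner_eq_zero_of_self [μ.IsAddHaarMeasure] (hL : IsIsotropic L) {f : Wave n}
    (hf : physInner L μ f f = 0) (g : Wave n) : physInner L μ g f = 0 := by
  have : μ.IsNegInvariant := Measure.IsAddHaarMeasure.isNegInvariant_of_regular μ
  let core : PreInnerProductSpace.Core ℂ (Wave n) :=
    { inner := physInner L μ
      conj_inner_symm := fun f g => conj_physInner μ g f
      re_inner_nonneg := re_physInner_self_nonneg μ hL
      add_left := fun f f' g => by
        rw [← conj_physInner μ g, physInner_add_right, map_add, conj_physInner, conj_physInner]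
      smul_left := fun f g c => by
        rw [← conj_physInner μ g, physInner_smul_right, map_mul, conj_physInner] }
  have hCS : ‖physInner L μ g f‖ * ‖physInner L μ f g‖
      ≤ (physInner L μ g g).re * (physInner L μ f f).re :=
    InnerProductSpace.Core.inner_mul_inner_self_le (c := core) g f
  rw [hf, Complex.zero_re, mul_zero, ← conj_physInner μ g f, RCLike.norm_conj] at hCS
  exact norm_eq_zero.1 (mul_self_eq_zero.1 (le_antisymm hCS (mul_self_nonneg _)))

end PhysInner

section Gaussian

theorem norm_iteratedFDeriv_exp (i : ℕ) (x : ℝ) :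
    ‖iteratedFDeriv ℝ i Real.exp x‖ = Real.exp x := by
  rw [norm_iteratedFDeriv_eq_norm_iteratedDeriv, iteratedDeriv_eq_iterate, Real.iter_deriv_exp,
    Real.norm_eq_abs, Real.abs_exp]

theorem one_add_pow_mul_exp_neg_sq_le (N : ℕ) {t : ℝ} (ht : 0 ≤ t) :
    (1 + t) ^ N * Real.exp (-t ^ 2) ≤ N.factorial * Real.exp 2 := by
  have hpow : (1 + t) ^ N ≤ N.factorial * Real.exp (1 + t) :=
    (div_le_iff₀' (by positivity)).1 (Real.pow_div_factorial_le_exp (1 + t) (by positivity) N)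
  have hexp : Real.exp (1 + t) * Real.exp (-t ^ 2) ≤ Real.exp 2 := by
    rw [← Real.exp_add, Real.exp_le_exp]
    nlinarith [sq_nonneg (t - 1)]
  calc (1 + t) ^ N * Real.exp (-t ^ 2) ≤ N.factorial * Real.exp (1 + t) * Real.exp (-t ^ 2) := by
        gcongr
    _ ≤ N.factorial * Real.exp 2 := by rw [mul_assoc]; gcongr

section Schwartz

variable {E : Type*} [NormedAddCommGroup E] [InnerProductSpace ℝ E]

theorem exists_norm_iteratedFDeriv_exp_neg_norm_sq_le (m : ℕ) : ∃ (l : ℕ) (C : ℝ), 0 ≤ C ∧ ∀ x : E,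
    ‖iteratedFDeriv ℝ m (Real.exp ∘ fun y => -‖y‖ ^ 2) x‖
      ≤ C * (1 + ‖x‖) ^ l * Real.exp (-‖x‖ ^ 2) := by
  obtain ⟨l, C, hC, hgrowth⟩ :=
    (Function.hasTemperateGrowth_norm_sq (H := E)).neg.norm_iteratedFDeriv_le_uniform m
  refine ⟨l * m, m.factorial * (C + 1) ^ m, by positivity, fun x => ?_⟩
  have hx : 1 ≤ 1 + ‖x‖ := le_add_of_nonneg_right (norm_nonneg x)
  have hbase : 1 ≤ (C + 1) * (1 + ‖x‖) ^ l :=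
    one_le_mul_of_one_le_of_one_le (le_add_of_nonneg_left hC) (one_le_pow₀ hx)
  have h := norm_iteratedFDeriv_comp_le (𝕜 := ℝ) (N := (m : ℕ∞)) (n := m) Real.contDiff_exp
    (contDiff_norm_sq ℝ (E := E)).neg le_rfl x (C := Real.exp (-‖x‖ ^ 2))
    (D := (C + 1) * (1 + ‖x‖) ^ l) (fun i _ => (norm_iteratedFDeriv_exp i _).le)
    fun i hi him => by
      refine (hgrowth i him x).trans (le_trans ?_ (le_self_pow₀ hbase (by lia)))
      gcongr
      exact le_add_of_nonneg_right zero_le_one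
  refine h.trans_eq ?_
  rw [mul_pow, ← pow_mul]
  ring

/-- The Gaussian `e^{-‖x‖²}` as a real-valued Schwartz function on an inner product space. -/
noncomputable def gaussianSchwartz (E : Type*) [NormedAddCommGroup E] [InnerProductSpace ℝ E] :
    𝓢(E, ℝ) where
  toFun := Real.exp ∘ fun x => -‖x‖ ^ 2
  smooth' := Real.contDiff_exp.comp (contDiff_norm_sq ℝ).neg
  decay' k m := by
    obtain ⟨l, C, hC, h⟩ := exists_norm_iteratedFDeriv_exp_neg_norm_sq_le (E := E) m
    refine ⟨C * ((k + l).factorial * Real.exp 2), fun x => ?_⟩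
    calc _ ≤ (1 + ‖x‖) ^ k * (C * (1 + ‖x‖) ^ l * Real.exp (-‖x‖ ^ 2)) := by
          gcongr
          · exact le_add_of_nonneg_left zero_le_one
          · exact h x
      _ = C * ((1 + ‖x‖) ^ (k + l) * Real.exp (-‖x‖ ^ 2)) := by ring
      _ ≤ _ := mul_le_mul_of_nonneg_left (one_add_pow_mul_exp_neg_sq_le _ (norm_nonneg x)) hC

end Schwartz

variable {n : ℕ}

/-- The Gaussian wave function `e^{-‖ξ‖²}`, the vector exhibited outside the radical. -/
noncomputable def gaussianWave (n : ℕ) : Wave n :=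
  SchwartzMap.postcompCLM (𝕜 := ℝ) Complex.ofRealCLM (gaussianSchwartz (Config n))

theorem gaussianWave_apply (ξ : Config n) : gaussianWave n ξ = Real.exp (-‖ξ‖ ^ 2) := rfl

theorem weyl_add_half_smul (X : PhaseSpace n) (f : Config n → ℂ) (ξ : Config n) :
    weyl X f (ξ + (1 / 2 : ℝ) • X.2)
      = Complex.exp (Complex.I * (inner ℝ X.1 ξ : ℝ)) * f (ξ - (1 / 2 : ℝ) • X.2) := by
  have hphase : ∑ j, X.1 j * (ξ + (1 / 2 : ℝ) • X.2) j - (1 / 2) * ∑ j, X.1 j * X.2 j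
      = inner ℝ X.1 ξ := by
    simp only [PiLp.inner_apply, RCLike.inner_apply, conj_trivial, Finset.mul_sum,
      ← Finset.sum_sub_distrib, PiLp.add_apply, PiLp.smul_apply, smul_eq_mul]
    exact Finset.sum_congr rfl fun j _ => by ring
  rw [weyl, hphase, show ξ + (1 / 2 : ℝ) • X.2 - X.2 = ξ - (1 / 2 : ℝ) • X.2 by module]

theorem norm_add_half_smul_sq_add_norm_sub_half_smul_sq (ξ q : Config n) :
    ‖ξ + (1 / 2 : ℝ) • q‖ ^ 2 + ‖ξ - (1 / 2 : ℝ) • q‖ ^ 2 = 2 * ‖ξ‖ ^ 2 + ‖q‖ ^ 2 / 2 := by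
  have h := parallelogram_law_with_norm ℝ ξ ((1 / 2 : ℝ) • q)
  rw [norm_smul ((1 : ℝ) / 2) q, Real.norm_of_nonneg one_half_pos.le] at h
  linear_combination h

theorem waveInner_gaussianWave (X : PhaseSpace n) :
    waveInner (gaussianWave n) (weyl X (gaussianWave n))
      = ((Real.pi / 2) ^ (n / 2 : ℝ) * Real.exp (-(‖X.1‖ ^ 2 / 8 + ‖X.2‖ ^ 2 / 2)) : ℝ) := by
  have hintegrand (ξ : Config n) :
      conj (gaussianWave n (ξ + (1 / 2 : ℝ) • X.2))
          * weyl X (gaussianWave n) (ξ + (1 / 2 : ℝ) • X.2)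
        = Complex.exp (-(‖X.2‖ ^ 2 / 2 : ℝ))
          * Complex.exp (-2 * ‖ξ‖ ^ 2 + Complex.I * (inner ℝ X.1 ξ : ℝ)) := by
    have h := congrArg ((↑) : ℝ → ℂ) (norm_add_half_smul_sq_add_norm_sub_half_smul_sq ξ X.2)
    simp only [weyl_add_half_smul, gaussianWave_apply, Complex.conj_ofReal]
    push_cast at h ⊢
    rw [← Complex.exp_add, ← Complex.exp_add, ← Complex.exp_add]
    congr 1
    linear_combination -h
  have hgauss := GaussianFourier.integral_cexp_neg_mul_sq_norm_add_of_euclideanSpace (ι := Fin n)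
    (b := 2) (by norm_num) Complex.I X.1
  rw [waveInner, ← integral_add_right_eq_self _ ((1 / 2 : ℝ) • X.2)]
  simp only [hintegrand]
  rw [integral_const_mul, hgauss, Fintype.card_fin, mul_left_comm, ← Complex.exp_add,
    Complex.ofReal_mul, Complex.ofReal_cpow (by positivity), Complex.ofReal_exp, Complex.I_sq]
  push_cast
  ring_nf

theorem physInner_gaussianWave_ne_zero {L : Submodule ℝ (PhaseSpace n)} (μ : Measure L)
    [μ.HasTemperateGrowth] [NeZero μ] : physInner L μ (gaussianWave n) (gaussianWave n) ≠ 0 := by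
  have hcoeff : (Real.pi / 2) ^ (n / 2 : ℝ) ≠ 0 := (by positivity)
  have hint := (integrable_waveInner_weyl L μ (gaussianWave n) (gaussianWave n)).re.const_mul
    ((Real.pi / 2) ^ (n / 2 : ℝ))⁻¹
  simp only [waveInner_gaussianWave, RCLike.re_to_complex, Complex.ofReal_re,
    inv_mul_cancel_left₀ hcoeff] at hint
  simp only [physInner, waveInner_gaussianWave]
  rw [integral_complex_ofReal, integral_const_mul]
  exact Complex.ofReal_ne_zero.2 (mul_ne_zero hcoeff (integral_exp_pos hint).ne')

end Gaussian

section Quadratic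

variable {n : ℕ}

theorem Omega₂_tmul (x y : PhaseSpace n) (f : Wave n) :
    Omega₂ n (x ⊗ₜ y) f = Omega n x (Omega n y f) := rfl

theorem Omega₂_Omega {Γ : PhaseSpace n ⊗[ℝ] PhaseSpace n} (hΓ : Γ ∈ symTensor (n := n) ⊤ ⊤)
    (X : PhaseSpace n) (f : Wave n) :
    Omega₂ n Γ (Omega n X f)
      = Omega n X (Omega₂ n Γ f)
        + (2 * Complex.I) • Omega n (contractRight (symp n X) Γ) f := by
  induction hΓ using Submodule.span_induction with
  | mem t ht =>
    obtain ⟨x, -, y, -, rfl⟩ := ht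
    have hcomm (Z : PhaseSpace n) (g : Wave n) :
        Omega n Z (Omega n X g) = Omega n X (Omega n Z g) + (Complex.I * symp n X Z) • g := by
      rw [Omega_Omega X Z, sub_add_cancel]
    simp only [map_add, LinearMap.add_apply, Omega₂_tmul, hcomm, map_smul, contractRight_tmul,
      LinearMap.smul_apply, ← Complex.coe_smul]
    module
  | zero => simp
  | add s t _ _ hs ht =>
    simp only [map_add, LinearMap.add_apply, hs, ht]
    module
  | smul c t _ ht =>
    simp only [map_smul, LinearMap.smul_apply, ht, ← Complex.coe_smul]
    module

end Quadratic

section NullSpace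

variable {n : ℕ} {L : Submodule ℝ (PhaseSpace n)} (μ : Measure L)

/-- The radical of the form `⟨·, ·⟩`: the wave functions orthogonal to all others. For an isotropic
plane with a Haar measure these are the vectors of zero norm. -/
noncomputable def nullSpace [μ.HasTemperateGrowth] : Submodule ℂ (Wave n) where
  carrier := {f | ∀ g, physInner L μ g f = 0}
  zero_mem' g := by simpa using physInner_smul_right μ g 0 0
  add_mem' hf hf' g := by rw [physInner_add_right, hf, hf', add_zero]
  smul_mem' c f hf g := by rw [physInner_smul_right, hf, mul_zero]

theorem Omega_mem_nullSpace_of_mem_skewOrth [μ.HasTemperateGrowth] {Z : PhaseSpace n}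
    (hZ : Z ∈ skewOrth L) {f : Wave n} (hf : f ∈ nullSpace μ) : Omega n Z f ∈ nullSpace μ :=
  fun g => by rw [← physInner_Omega_left μ hZ, hf]

theorem gaussianWave_notMem_nullSpace [μ.HasTemperateGrowth] [NeZero μ] :
    gaussianWave n ∉ nullSpace μ :=
  fun h => physInner_gaussianWave_ne_zero μ (h _)

theorem Omega₂_mem_nullSpace [μ.HasTemperateGrowth] {Γ : PhaseSpace n ⊗[ℝ] PhaseSpace n}
    (hΓ : Γ ∈ symTensor (skewOrth L) (skewOrth L)) {f : Wave n} (hf : f ∈ nullSpace μ) :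
    Omega₂ n Γ f ∈ nullSpace μ := by
  induction hΓ using Submodule.span_induction with
  | mem t ht =>
    obtain ⟨x, hx, y, hy, rfl⟩ := ht
    rw [map_add, LinearMap.add_apply, Omega₂_tmul, Omega₂_tmul]
    exact add_mem
      (Omega_mem_nullSpace_of_mem_skewOrth μ hx (Omega_mem_nullSpace_of_mem_skewOrth μ hy hf))
      (Omega_mem_nullSpace_of_mem_skewOrth μ hy (Omega_mem_nullSpace_of_mem_skewOrth μ hx hf))
  | zero => simp
  | add s t _ _ hs ht => rw [map_add]; exact add_mem hs ht
  | smul c t _ ht => rw [map_smul]; exact Submodule.smul_of_tower_mem _ c ht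

theorem mem_of_Omega_mem_nullSpace [μ.HasTemperateGrowth] [NeZero μ] {Z : PhaseSpace n}
    (hZ : ∀ f : Wave n, Omega n Z f ∈ nullSpace μ) : Z ∈ L := by
  rw [← skewOrth_skewOrth L]
  intro Y hY
  by_contra hne
  have hscalar : (Complex.I * symp n Y Z) • gaussianWave n ∈ nullSpace μ := by
    have h := sub_mem (hZ (Omega n Y (gaussianWave n)))
      (Omega_mem_nullSpace_of_mem_skewOrth μ hY (hZ (gaussianWave n)))
    rwa [Omega_Omega Y Z, sub_sub_cancel] at h
  have hunit : Complex.I * symp n Y Z ≠ 0 :=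
    mul_ne_zero Complex.I_ne_zero (Complex.ofReal_ne_zero.2 hne)
  exact gaussianWave_notMem_nullSpace μ ((Submodule.smul_mem_iff _ hunit).1 hscalar)

variable [μ.IsAddHaarMeasure]

theorem gaugeEquiv_iff_sub_mem_nullSpace (hL : IsIsotropic L) {f g : Wave n} :
    GaugeEquiv L μ f g ↔ f - g ∈ nullSpace μ :=
  ⟨physInner_eq_zero_of_self μ hL, fun h => h _⟩

theorem preservesEquiv_iff_mem_nullSpace (hL : IsIsotropic L) {H : Module.End ℂ (Wave n)} :
    PreservesEquiv L μ H ↔ ∀ f ∈ nullSpace μ, H f ∈ nullSpace μ := by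
  simp only [PreservesEquiv, gaugeEquiv_iff_sub_mem_nullSpace μ hL]
  refine ⟨fun h f hf => ?_, fun h f g hfg => ?_⟩
  · simpa using h f 0 (by simpa using hf)
  · simpa using h (f - g) hfg

theorem Omega_mem_nullSpace_of_mem (hL : IsIsotropic L) {X : PhaseSpace n} (hX : X ∈ L)
    (f : Wave n) : Omega n X f ∈ nullSpace μ :=
  fun g => physInner_Omega_right_eq_zero μ hL hX g f

theorem exists_Omega₂_sub_smul_mem_nullSpace (hL : IsIsotropic L)
    {Γ : PhaseSpace n ⊗[ℝ] PhaseSpace n} (hΓ : Γ ∈ symTensor L ⊤) :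
    ∃ r : ℝ, ∀ f : Wave n, Omega₂ n Γ f - (r * Complex.I) • f ∈ nullSpace μ := by
  induction hΓ using Submodule.span_induction with
  | mem t ht =>
    obtain ⟨x, hx, y, -, rfl⟩ := ht
    refine ⟨-symp n y x, fun f => ?_⟩
    convert! (nullSpace μ).smul_mem 2 (Omega_mem_nullSpace_of_mem μ hL hx (Omega n y f)) using 1
    rw [map_add, LinearMap.add_apply, Omega₂_tmul, Omega₂_tmul, Omega_Omega y x,
      Complex.ofReal_neg]
    module
  | zero => exact ⟨0, fun f => by simp⟩
  | add s t _ _ hs ht =>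
    obtain ⟨r, hr⟩ := hs
    obtain ⟨r', hr'⟩ := ht
    refine ⟨r + r', fun f => ?_⟩
    convert! add_mem (hr f) (hr' f) using 1
    rw [map_add, LinearMap.add_apply, Complex.ofReal_add]
    module
  | smul c t _ ht =>
    obtain ⟨r, hr⟩ := ht
    refine ⟨c * r, fun f => ?_⟩
    convert! (nullSpace μ).smul_mem (c : ℂ) (hr f) using 1
    rw [map_smul, LinearMap.smul_apply, ← Complex.coe_smul, Complex.ofReal_mul]
    module

theorem contractRight_mem_of_preservesEquiv (hL : IsIsotropic L)
    {Γ : PhaseSpace n ⊗[ℝ] PhaseSpace n} (hΓ : Γ ∈ symTensor (n := n) ⊤ ⊤) {ε : ℂ}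
    (h : PreservesEquiv L μ (Omega₂ n Γ + ε • 1)) {X : PhaseSpace n} (hX : X ∈ L) :
    contractRight (symp n X) Γ ∈ L := by
  refine mem_of_Omega_mem_nullSpace μ fun f => ?_
  have hΩ := Omega_mem_nullSpace_of_mem μ hL hX
  have hH : Omega₂ n Γ (Omega n X f) + ε • Omega n X f ∈ nullSpace μ :=
    (preservesEquiv_iff_mem_nullSpace μ hL).1 h _ (hΩ f)
  rw [Omega₂_Omega hΓ, (nullSpace μ).add_mem_iff_left ((nullSpace μ).smul_mem ε (hΩ f)),
    (nullSpace μ).add_mem_iff_right (hΩ _)] at hH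
  exact ((nullSpace μ).smul_mem_iff (mul_ne_zero two_ne_zero Complex.I_ne_zero)).1 hH

theorem mem_sup_of_preservesEquiv (hL : IsIsotropic L)
    {Γ : PhaseSpace n ⊗[ℝ] PhaseSpace n} (hΓ : Γ ∈ symTensor (n := n) ⊤ ⊤) {ε : ℂ}
    (h : PreservesEquiv L μ (Omega₂ n Γ + ε • 1)) :
    Γ ∈ symTensor (skewOrth L) (skewOrth L) ⊔ symTensor L ⊤ := by
  refine mem_symTensor_sup_of_contractRight_mem hL.le_skewOrth hΓ fun φ hφ => ?_
  obtain ⟨X, hX, rfl⟩ := exists_symp_eq hφ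
  exact contractRight_mem_of_preservesEquiv μ hL hΓ h hX

theorem exists_gaugeEquiv_of_mem_sup (hL : IsIsotropic L) {Γ : PhaseSpace n ⊗[ℝ] PhaseSpace n}
    (hΓ : Γ ∈ symTensor (skewOrth L) (skewOrth L) ⊔ symTensor L ⊤) (ε : ℂ) :
    ∃ Γ' ∈ symTensor (skewOrth L) (skewOrth L), ∃ ε' : ℂ, ε'.re = ε.re ∧
      ∀ f : Wave n, GaugeEquiv L μ ((Omega₂ n Γ + ε • 1 : Module.End ℂ (Wave n)) f)
        (Omega₂ n Γ' f + ε' • f) := by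
  obtain ⟨Γ', hΓ', Δ, hΔ, rfl⟩ := Submodule.mem_sup.1 hΓ
  obtain ⟨r, hr⟩ := exists_Omega₂_sub_smul_mem_nullSpace μ hL hΔ
  refine ⟨Γ', hΓ', ε + r * Complex.I, by simp, fun f => ?_⟩
  rw [gaugeEquiv_iff_sub_mem_nullSpace μ hL]
  convert! hr f using 1
  rw [map_add, LinearMap.add_apply, LinearMap.add_apply, LinearMap.smul_apply, Module.End.one_apply]
  module

end NullSpace

end ConstrainedQuadratic

open ConstrainedQuadratic in
theorem lemma16_general (n : ℕ) (L : Submodule ℝ (PhaseSpace n)) (hL : IsIsotropic L)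
    (μ : Measure L) [μ.IsAddHaarMeasure]
    (Γ : PhaseSpace n ⊗[ℝ] PhaseSpace n) (hΓ : Γ ∈ symTensor (n := n) ⊤ ⊤) (ε : ℂ) :
    (PreservesEquiv L μ (Omega₂ n Γ + ε • 1) ↔
      Γ ∈ symTensor (skewOrth L) (skewOrth L) ⊔ symTensor L ⊤) ∧
    (PreservesEquiv L μ (Omega₂ n Γ + ε • 1) →
      ∃ Γ' ∈ symTensor (skewOrth L) (skewOrth L), ∃ ε' : ℂ, ε'.re = ε.re ∧
        ∀ f : Wave n, GaugeEquiv L μ ((Omega₂ n Γ + ε • 1 : Module.End ℂ (Wave n)) f)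
          (Omega₂ n Γ' f + ε' • f)) := by
  refine ⟨⟨mem_sup_of_preservesEquiv μ hL hΓ, fun h => ?_⟩, fun h =>
    exists_gaugeEquiv_of_mem_sup μ hL (mem_sup_of_preservesEquiv μ hL hΓ h) ε⟩
  obtain ⟨Γ', hΓ', ε', -, hequiv⟩ := exists_gaugeEquiv_of_mem_sup μ hL h ε
  refine (preservesEquiv_iff_mem_nullSpace μ hL).2 fun f hf => ?_
  have hreduced : Omega₂ n Γ' f + ε' • f ∈ nullSpace μ :=
    add_mem (Omega₂_mem_nullSpace μ hΓ' hf) ((nullSpace μ).smul_mem ε' hf)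
  exact ((nullSpace μ).sub_mem_iff_left hreduced).1
    ((gaugeEquiv_iff_sub_mem_nullSpace μ hL).1 (hequiv f))

open ConstrainedQuadratic in
theorem lemma16 (n : ℕ) (L : Submodule ℝ (PhaseSpace n)) (hL : IsIsotropic L)
    (μ : Measure L) [μ.IsAddHaarMeasure]
    (Γ : PhaseSpace n ⊗[ℝ] PhaseSpace n) (hΓ : Γ ∈ symTensor (n := n) ⊤ ⊤) (ε : ℝ) :
    (PreservesEquiv L μ (quadHam Γ ε) ↔
      Γ ∈ symTensor (skewOrth L) (skewOrth L) ⊔ symTensor L ⊤) ∧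
    (PreservesEquiv L μ (quadHam Γ ε) →
      ∃ Γ' ∈ symTensor (skewOrth L) (skewOrth L), ∃ ε' : ℂ, ε'.re = ε ∧
        ∀ f : Wave n, GaugeEquiv L μ (quadHam Γ ε f) (Omega₂ n Γ' f + ε' • f)) :=
  lemma16_general n L hL μ Γ hΓ ε
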